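/- Terminology. A function $h:\,]0,\infty[\,\to\mathbb{R}$ is completely monotonic if it is $C^\infty$ and $(-1)^n h^{(n)}(x)\ge 0$ for all integers $n\ge 0$ and all $x>0$. It is LICM if, in addition, it is locally integrable on $[0,\infty[$ (equivalently, integrable near $0$). A Bernstein function is a non-negative differentiable function on $]0,\infty[$ whose derivative is LICM. A CrF is a function $f:[0,\infty[\,\to\mathbb{R}$ that is non-negative, non-decreasing and concave. The Laplace transform of $f$ is $\tilde f(x)=\int_0^\infty e^{-xt}f(t)\,dt$. Theorem. (i) If $f$ is a CrF, then the integral defining $\tilde f(x)$ converges absolutely for every $x>0$, and $g(x):=x^2\tilde f(x)$ is a Bernstein function; moreover $g$ has a finite, non-negative limit as $x\to 0^+$, so that it extends continuously to $[0,\infty[$. (ii) If $f$ is a Bernstein function, then there is a CrF $g$ such that, for every $x>0$, the integral defining $\tilde g(x)$ converges absolutely and $f(x)=x^2\,\tilde g(x)$. -/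

import Mathlib

open Set Filter Topology MeasureTheory
open scoped ContDiff

noncomputable section

/-- A real function on `]0,∞[` is completely monotonic: it is smooth there and
`(-1)^n D^n f ≥ 0` for every `n ≥ 0`. Values outside `]0,∞[` play no role. -/
def IsCompletelyMonotonic (f : ℝ → ℝ) : Prop :=
  ContDiffOn ℝ ∞ f (Ioi 0) ∧
    ∀ (n : ℕ) (x : ℝ), 0 < x → 0 ≤ (-1) ^ n * iteratedDerivWithin n f (Ioi 0) x

/-- Locally integrable completely monotonic functions: local integrability is meant on
`[0,∞[`, so it is a condition on the behaviour at `0`. -/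
def IsLICM (f : ℝ → ℝ) : Prop :=
  IsCompletelyMonotonic f ∧ LocallyIntegrableOn f (Ici 0) volume

/-- Bernstein functions: non-negative functions on `]0,∞[` with an LICM derivative.
Values outside `]0,∞[` play no role. -/
def IsBernsteinFunction (f : ℝ → ℝ) : Prop :=
  (∀ x : ℝ, 0 < x → 0 ≤ f x) ∧ DifferentiableOn ℝ f (Ioi 0) ∧ IsLICM (deriv f)

/-- The class CrF: functions on `[0,∞[` that are non-negative, non-decreasing and concave.
Values at negative arguments play no role. -/
def IsCrF (f : ℝ → ℝ) : Prop :=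
  (∀ t : ℝ, 0 ≤ t → 0 ≤ f t) ∧ MonotoneOn f (Ici 0) ∧ ConcaveOn ℝ (Ici 0) f

/-- The integral defining the Laplace transform of `f` at `x` converges absolutely. -/
def HasLaplaceTransformAt (f : ℝ → ℝ) (x : ℝ) : Prop :=
  IntegrableOn (fun t : ℝ => Real.exp (-(x * t)) * f t) (Ioi 0) volume

/-- The Laplace transform `∫₀^∞ e^{-xt} f(t) dt` at a real argument `x`. -/
def laplaceTransform (f : ℝ → ℝ) (x : ℝ) : ℝ :=
  ∫ t in Ioi (0 : ℝ), Real.exp (-(x * t)) * f t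

end

/-! (i) For n ≥ 1, the n-th derivative of x² f̃(x) is (-1)^n times the integral of e^{-xt} t^(n-2)
x² (t-a)(t-b) f(t), where a, b = (n ∓ √n)/x. By concavity, f minus its chord through a and b has the
sign opposite to (t-a)(t-b), so replacing f by the chord can only increase the integral. For the
chord α + βt the function is αx + β, whose derivatives are explicit; this gives all signs
(`IsCrF.sqMulLaplaceDeriv_succ_nonneg`). Being monotone and bounded below, x² f̃(x) has a limit at
0, whence the integrability of its derivative.

(ii) The functions x² g̃(x) with g a CrF form a convex cone that contains the non-negative constants
and all 1 - e^{-xu}, and is closed under pointwise limits by Helly selection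
(`IsSqMulLaplaceOfCrF.of_tendsto`). The Taylor polynomial of f at T, evaluated at T(1 - e^{-x/T}),
lies in this cone. It converges to f(T(1 - e^{-x/T})) as the order grows
(`IsBernsteinSequence.tendsto_taylorSum`), and then T → ∞ recovers f(x). No representing measure is
needed. -/

theorem integrableOn_exp_neg_mul_pow (k : ℕ) {x : ℝ} (hx : 0 < x) :
    IntegrableOn (fun t : ℝ => Real.exp (-(x * t)) * t ^ k) (Ioi 0) := by
  have h := integrableOn_rpow_mul_exp_neg_mul_rpow (p := 1) (s := k) (b := x)
    (by linarith [Nat.cast_nonneg (α := ℝ) k]) one_pos hx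
  refine h.congr_fun (fun t _ => ?_) measurableSet_Ioi
  simp [Real.rpow_natCast, mul_comm]

theorem integral_exp_neg_mul_pow (k : ℕ) {x : ℝ} (hx : 0 < x) :
    ∫ t in Ioi (0 : ℝ), Real.exp (-(x * t)) * t ^ k = k.factorial / x ^ (k + 1) := by
  have h := Real.integral_rpow_mul_exp_neg_mul_Ioi (a := (k : ℝ) + 1) (r := x)
    (by positivity) hx
  rw [Real.Gamma_nat_eq_factorial, one_div, Real.inv_rpow hx.le] at h
  have hc : ∀ y : ℝ, y ^ ((k : ℝ) + 1) = y ^ (k + 1) := fun y => by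
    rw [← Real.rpow_natCast]
    push_cast
    rfl
  rw [hc] at h
  rw [div_eq_inv_mul, ← h]
  refine setIntegral_congr_fun measurableSet_Ioi (fun t _ => ?_)
  simp [Real.rpow_natCast, mul_comm]

/-! ### Growth of CrFs and convergence of their Laplace integrals -/

namespace IsCrF

variable {f : ℝ → ℝ}

/-- Monotonicity handles t ≤ 1; beyond, concavity on [0, t] at the point 1 and f 0 ≥ 0 give f t ≤ t
f 1. This bound dominates every integral below. -/
theorem le_linear (hf : IsCrF f) {t : ℝ} (ht : 0 ≤ t) : f t ≤ f 1 * (1 + t) := by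
  obtain ⟨h0, hm, hc⟩ := hf
  have h1 := h0 1 zero_le_one
  rcases le_or_gt t 1 with h | h
  · nlinarith [hm ht (by simp : (1 : ℝ) ∈ Ici 0) h, mul_nonneg h1 ht]
  · have htp : 0 < t := by linarith
    have := hc.2 (show (0 : ℝ) ∈ Ici 0 by simp) (show t ∈ Ici 0 from ht)
      (show 0 ≤ 1 - 1 / t by rw [sub_nonneg, div_le_one htp]; exact h.le) (show 0 ≤ 1 / t by positivity) (by ring)
    simp only [smul_eq_mul, mul_zero, zero_add, one_div, inv_mul_cancel₀ htp.ne'] at this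
    have h2 : 0 ≤ (1 - t⁻¹) * f 0 :=
      mul_nonneg (by rw [sub_nonneg]; exact inv_le_one_of_one_le₀ h.le) (h0 0 le_rfl)
    have h3 : t⁻¹ * f t ≤ f 1 := by linarith
    rw [inv_mul_le_iff₀ htp] at h3
    nlinarith

theorem aestronglyMeasurable (hf : IsCrF f) :
    AEStronglyMeasurable f (volume.restrict (Ioi 0)) :=
  (aemeasurable_restrict_of_monotoneOn measurableSet_Ioi
    (hf.2.1.mono Ioi_subset_Ici_self)).aestronglyMeasurable

theorem aestronglyMeasurable_exp_mul_pow_mul (hf : IsCrF f) (k : ℕ) (x : ℝ) :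
    AEStronglyMeasurable (fun t : ℝ => Real.exp (-(x * t)) * (t ^ k * f t))
      (volume.restrict (Ioi 0)) := by
  have h : Continuous fun t : ℝ => Real.exp (-(x * t)) := by fun_prop
  exact h.aestronglyMeasurable.mul ((continuous_pow k).aestronglyMeasurable.mul
    hf.aestronglyMeasurable)

theorem integrableOn_linear_bound (f : ℝ → ℝ) (k : ℕ) {x : ℝ} (hx : 0 < x) :
    IntegrableOn (fun t : ℝ => Real.exp (-(x * t)) * (t ^ k * (f 1 * (1 + t)))) (Ioi 0) := by
  have := ((integrableOn_exp_neg_mul_pow k hx).add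
    (integrableOn_exp_neg_mul_pow (k + 1) hx)).const_mul (f 1)
  refine IntegrableOn.congr_fun this (fun t _ => ?_) measurableSet_Ioi
  simp only [Pi.add_apply]
  ring

theorem norm_exp_mul_pow_mul_le (hf : IsCrF f) (k : ℕ) {x y t : ℝ} (hxy : y ≤ x) (ht : 0 < t) :
    ‖Real.exp (-(x * t)) * (t ^ k * f t)‖ ≤
      Real.exp (-(y * t)) * (t ^ k * (f 1 * (1 + t))) := by
  have h1 := hf.le_linear ht.le
  have h0 := hf.1 t ht.le
  rw [Real.norm_of_nonneg (by positivity)]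
  gcongr

theorem integrableOn_exp_mul_pow_mul (hf : IsCrF f) (k : ℕ) {x : ℝ} (hx : 0 < x) :
    IntegrableOn (fun t : ℝ => Real.exp (-(x * t)) * (t ^ k * f t)) (Ioi 0) := by
  refine (integrableOn_linear_bound f k hx).mono' (hf.aestronglyMeasurable_exp_mul_pow_mul k x) ?_
  filter_upwards [self_mem_ae_restrict measurableSet_Ioi] with t ht
  exact hf.norm_exp_mul_pow_mul_le k le_rfl ht

theorem hasLaplaceTransformAt (hf : IsCrF f) {x : ℝ} (hx : 0 < x) :
    HasLaplaceTransformAt f x := by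
  simpa [HasLaplaceTransformAt] using hf.integrableOn_exp_mul_pow_mul 0 hx

end IsCrF

/-! ### Derivatives of x² f̃(x) and their signs -/

/-- The Laplace transform of `t ^ k * f t`. -/
noncomputable def laplaceMoment (f : ℝ → ℝ) (k : ℕ) (x : ℝ) : ℝ :=
  ∫ t in Ioi (0 : ℝ), Real.exp (-(x * t)) * (t ^ k * f t)

theorem laplaceMoment_zero (f : ℝ → ℝ) : laplaceMoment f 0 = laplaceTransform f := by
  ext x
  simp [laplaceMoment, laplaceTransform]

theorem IsCrF.hasDerivAt_laplaceMoment {f : ℝ → ℝ} (hf : IsCrF f) (k : ℕ) {x : ℝ} (hx : 0 < x) :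
    HasDerivAt (laplaceMoment f k) (-laplaceMoment f (k + 1) x) x := by
  have hs : Ioi (x / 2) ∈ 𝓝 x := Ioi_mem_nhds (by linarith)
  have h := hasDerivAt_integral_of_dominated_loc_of_deriv_le (μ := volume.restrict (Ioi 0))
    (F := fun y t : ℝ => Real.exp (-(y * t)) * (t ^ k * f t))
    (F' := fun y t : ℝ => -(Real.exp (-(y * t)) * (t ^ (k + 1) * f t))) (x₀ := x)
    (bound := fun t => Real.exp (-(x / 2 * t)) * (t ^ (k + 1) * (f 1 * (1 + t)))) hs
    (Eventually.of_forall fun y => hf.aestronglyMeasurable_exp_mul_pow_mul k y)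
    (hf.integrableOn_exp_mul_pow_mul k hx)
    (hf.aestronglyMeasurable_exp_mul_pow_mul (k + 1) x).neg ?_
    (IsCrF.integrableOn_linear_bound f (k + 1) (half_pos hx)) ?_
  · rw [laplaceMoment, ← integral_neg]
    exact h.2
  · filter_upwards [self_mem_ae_restrict measurableSet_Ioi] with t ht y hy
    rw [norm_neg]
    exact hf.norm_exp_mul_pow_mul_le (k + 1) (le_of_lt hy) ht
  · refine Eventually.of_forall fun t y _ => ?_
    have h1 : HasDerivAt (fun y : ℝ => -(y * t)) (-t) y := by
      simpa using ((hasDerivAt_id' y).mul_const t).fun_neg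
    refine (h1.exp.mul_const (t ^ k * f t)).congr_deriv ?_
    ring

/-- The `n`-th derivative of `x ^ 2 * laplaceTransform f x`. -/
noncomputable def sqMulLaplaceDeriv (f : ℝ → ℝ) (n : ℕ) (x : ℝ) : ℝ :=
  (-1) ^ n * (x ^ 2 * laplaceMoment f n x - 2 * n * x * laplaceMoment f (n - 1) x +
    n * (n - 1) * laplaceMoment f (n - 2) x)

theorem sqMulLaplaceDeriv_zero (f : ℝ → ℝ) :
    sqMulLaplaceDeriv f 0 = fun x => x ^ 2 * laplaceTransform f x := by
  ext x
  simp [sqMulLaplaceDeriv, laplaceMoment_zero]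

theorem IsCrF.hasDerivAt_sqMulLaplaceDeriv {f : ℝ → ℝ} (hf : IsCrF f) (n : ℕ) {x : ℝ}
    (hx : 0 < x) : HasDerivAt (sqMulLaplaceDeriv f n) (sqMulLaplaceDeriv f (n + 1) x) x := by
  have hM := fun k => hf.hasDerivAt_laplaceMoment k hx
  have h := ((((hasDerivAt_pow 2 x).mul (hM n)).sub
    (((hasDerivAt_id x).const_mul (2 * n : ℝ)).mul (hM (n - 1)))).add
    ((hM (n - 2)).const_mul (n * (n - 1) : ℝ))).const_mul ((-1 : ℝ) ^ n)
  refine h.congr_deriv ?_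
  -- For n = 0, 1 the subtractions n - 1, n - 2 truncate, but the coefficients n and n(n-1) vanish
  -- there.
  rcases n with _ | _ | n
  · simp [sqMulLaplaceDeriv]; ring
  · simp [sqMulLaplaceDeriv]; ring
  · simp only [sqMulLaplaceDeriv, Nat.add_sub_cancel, Nat.reduceSubDiff, id]
    push_cast
    ring

/-- A concave function lies above its chord between the nodes and below it outside. -/
theorem ConcaveOn.sub_chord_mul_nonpos {f : ℝ → ℝ} {s : Set ℝ} (hf : ConcaveOn ℝ s f) {a b t : ℝ}
    (ha : a ∈ s) (hb : b ∈ s) (ht : t ∈ s) (hab : a < b) :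
    (t - a) * (t - b) * (f t - (f a + (t - a) * ((f b - f a) / (b - a)))) ≤ 0 := by
  have hba : 0 < b - a := sub_pos.2 hab
  have key : ∀ {u v w : ℝ}, u ∈ s → w ∈ s → u < v → v < w →
      (w - v) * f u + (v - u) * f w ≤ (w - u) * f v := by
    intro u v w hu hw huv hvw
    have := hf.slope_anti_adjacent hu hw huv hvw
    rw [div_le_div_iff₀ (sub_pos.2 hvw) (sub_pos.2 huv)] at this
    nlinarith
  have e : f t - (f a + (t - a) * ((f b - f a) / (b - a))) =
      ((b - a) * f t - ((b - t) * f a + (t - a) * f b)) / (b - a) := by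
    field_simp
    ring
  rw [e, ← mul_div_assoc]
  refine div_nonpos_of_nonpos_of_nonneg ?_ hba.le
  rcases lt_trichotomy t a with h | rfl | h
  · exact mul_nonpos_of_nonneg_of_nonpos (mul_nonneg_of_nonpos_of_nonpos (by linarith) (by linarith))
      (by nlinarith [key ht hb h hab])
  · simp
  · rcases lt_trichotomy t b with h' | rfl | h'
    · exact mul_nonpos_of_nonpos_of_nonneg (mul_nonpos_of_nonneg_of_nonpos (by linarith)
        (by linarith)) (by nlinarith [key ha hb h h'])
    · simp
    · exact mul_nonpos_of_nonneg_of_nonpos (mul_nonneg (by linarith) (by linarith))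
        (by nlinarith [key ha ht hab h'])

theorem sqMulLaplaceDeriv_eq_integral {f : ℝ → ℝ} {x : ℝ} (n : ℕ)
    (hf : ∀ k, IntegrableOn (fun t : ℝ => Real.exp (-(x * t)) * (t ^ k * f t)) (Ioi 0)) :
    IntegrableOn (fun t : ℝ => Real.exp (-(x * t)) *
      (x ^ 2 * t ^ n - 2 * n * x * t ^ (n - 1) + n * (n - 1) * t ^ (n - 2)) * f t) (Ioi 0) ∧
    sqMulLaplaceDeriv f n x = (-1) ^ n * ∫ t in Ioi (0 : ℝ), Real.exp (-(x * t)) *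
      (x ^ 2 * t ^ n - 2 * n * x * t ^ (n - 1) + n * (n - 1) * t ^ (n - 2)) * f t := by
  have h1 := (hf n).const_mul (x ^ 2)
  have h2 := (hf (n - 1)).const_mul (2 * n * x)
  have h3 := (hf (n - 2)).const_mul (n * (n - 1) : ℝ)
  have e : (fun t : ℝ => Real.exp (-(x * t)) *
      (x ^ 2 * t ^ n - 2 * n * x * t ^ (n - 1) + n * (n - 1) * t ^ (n - 2)) * f t) =
      fun t => x ^ 2 * (Real.exp (-(x * t)) * (t ^ n * f t)) -
        2 * n * x * (Real.exp (-(x * t)) * (t ^ (n - 1) * f t)) +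
        n * (n - 1) * (Real.exp (-(x * t)) * (t ^ (n - 2) * f t)) := by
    ext t
    ring
  have h12 : IntegrableOn (fun t : ℝ => x ^ 2 * (Real.exp (-(x * t)) * (t ^ n * f t)) -
      2 * n * x * (Real.exp (-(x * t)) * (t ^ (n - 1) * f t))) (Ioi 0) := h1.sub h2
  refine ⟨e ▸ h12.add h3, ?_⟩
  rw [e, integral_add h12 h3, integral_sub h1 h2, integral_const_mul, integral_const_mul,
    integral_const_mul]
  rfl

theorem integrableOn_exp_mul_pow_mul_affine (α β : ℝ) {x : ℝ} (hx : 0 < x) (k : ℕ) :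
    IntegrableOn (fun t : ℝ => Real.exp (-(x * t)) * (t ^ k * (α + β * t))) (Ioi 0) := by
  refine IntegrableOn.congr_fun (((integrableOn_exp_neg_mul_pow k hx).const_mul α).add
    ((integrableOn_exp_neg_mul_pow (k + 1) hx).const_mul β)) (fun t _ => ?_) measurableSet_Ioi
  simp only [Pi.add_apply]
  ring

theorem laplaceMoment_affine (α β : ℝ) {x : ℝ} (hx : 0 < x) (k : ℕ) :
    laplaceMoment (fun t => α + β * t) k x =
      α * (k.factorial / x ^ (k + 1)) + β * ((k + 1).factorial / x ^ (k + 2)) := by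
  rw [← integral_exp_neg_mul_pow k hx, ← integral_exp_neg_mul_pow (k + 1) hx,
    ← integral_const_mul, ← integral_const_mul,
    ← integral_add ((integrableOn_exp_neg_mul_pow k hx).const_mul α)
      ((integrableOn_exp_neg_mul_pow (k + 1) hx).const_mul β)]
  refine integral_congr_ae (Eventually.of_forall fun t => ?_)
  simp only
  ring

/-- x² times the transform of α + βt is αx + β. -/
theorem sqMulLaplaceDeriv_one_affine (α β : ℝ) {x : ℝ} (hx : 0 < x) :
    sqMulLaplaceDeriv (fun t => α + β * t) 1 x = α := by
  simp only [sqMulLaplaceDeriv, laplaceMoment_affine α β hx]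
  norm_num [Nat.factorial]
  field_simp
  ring

theorem sqMulLaplaceDeriv_add_two_affine (n : ℕ) (α β : ℝ) {x : ℝ} (hx : 0 < x) :
    sqMulLaplaceDeriv (fun t => α + β * t) (n + 2) x = 0 := by
  simp only [sqMulLaplaceDeriv, laplaceMoment_affine α β hx, Nat.add_sub_cancel,
    show n + 2 - 1 = n + 1 by omega, Nat.factorial_succ]
  push_cast
  field_simp
  ring

theorem IsCrF.sqMulLaplaceDeriv_le_affine {f : ℝ → ℝ} (hf : IsCrF f) {n : ℕ} (hn : 1 ≤ n) {x : ℝ}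
    (hx : 0 < x) : ∃ α β : ℝ, (n = 1 → 0 ≤ α) ∧
      (-1) ^ n * sqMulLaplaceDeriv f n x ≤
        (-1) ^ n * sqMulLaplaceDeriv (fun t => α + β * t) n x := by
  have hn' : (1 : ℝ) ≤ n := by exact_mod_cast hn
  set r := Real.sqrt n with hr
  have hr2 : r ^ 2 = n := Real.sq_sqrt (by positivity)
  have hr1 : 1 ≤ r := Real.one_le_sqrt.2 hn'
  -- a and b are the roots of x²t² - 2nxt + n(n-1), the sign-changing factor of the kernel. For n =
  -- 1, a = 0 and the chord has intercept f 0 ≥ 0.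
  set a := (n - r) / x with ha
  set b := (n + r) / x with hb
  have ha0 : 0 ≤ a := div_nonneg (by nlinarith) hx.le
  have hab : a < b := by
    rw [ha, hb]
    gcongr
    linarith
  set β := (f b - f a) / (b - a) with hβ
  refine ⟨f a - a * β, β, ?_, ?_⟩
  · intro h1
    have : a = 0 := by
      rw [ha, hr, h1]
      simp
    rw [this, zero_mul, sub_zero]
    exact hf.1 0 le_rfl
  · have hf' := sqMulLaplaceDeriv_eq_integral n fun k => hf.integrableOn_exp_mul_pow_mul k hx
    have hl' := sqMulLaplaceDeriv_eq_integral n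
      fun k => integrableOn_exp_mul_pow_mul_affine (f a - a * β) β hx k
    rw [hf'.2, hl'.2, ← mul_assoc, ← mul_assoc, ← mul_pow]
    norm_num only [one_pow, one_mul]
    refine setIntegral_mono_on hf'.1 hl'.1 measurableSet_Ioi fun t ht => ?_
    have ht : 0 < t := ht
    have hch := hf.2.2.sub_chord_mul_nonpos ha0 (ha0.trans hab.le) ht.le hab
    rw [← hβ] at hch
    -- The factor t² makes the factorization free of the truncated exponent n - 2.
    have hw : t ^ 2 * (x ^ 2 * t ^ n - 2 * n * x * t ^ (n - 1) + n * (n - 1) * t ^ (n - 2)) =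
        t ^ n * (x ^ 2 * ((t - a) * (t - b))) := by
      have e1 : x ^ 2 * ((t - a) * (t - b)) = x ^ 2 * t ^ 2 - 2 * n * x * t + n * (n - 1) := by
        rw [ha, hb]
        field_simp
        linear_combination -hr2
      rw [e1]
      rcases n with _ | _ | n
      · omega
      · simp
        ring
      · simp only [Nat.add_sub_cancel, show n + 1 + 1 - 2 = n by omega]
        push_cast
        ring
    have h1 : t ^ 2 * ((x ^ 2 * t ^ n - 2 * n * x * t ^ (n - 1) + n * (n - 1) * t ^ (n - 2)) *
        (f t - (f a - a * β + β * t))) ≤ 0 := by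
      rw [← mul_assoc, hw]
      have : t ^ n * (x ^ 2 * ((t - a) * (t - b))) * (f t - (f a - a * β + β * t)) =
        (t ^ n * x ^ 2) * ((t - a) * (t - b) * (f t - (f a + (t - a) * β))) := by ring
      rw [this]
      exact mul_nonpos_of_nonneg_of_nonpos (by positivity) hch
    have h2 := nonpos_of_mul_nonpos_right h1 (by positivity)
    rw [mul_assoc, mul_assoc (Real.exp _)]
    refine mul_le_mul_of_nonneg_left ?_ (Real.exp_pos _).le
    linarith

theorem IsCrF.sqMulLaplaceDeriv_succ_nonneg {f : ℝ → ℝ} (hf : IsCrF f) (n : ℕ) {x : ℝ}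
    (hx : 0 < x) : 0 ≤ (-1) ^ n * sqMulLaplaceDeriv f (n + 1) x := by
  obtain ⟨α, β, h1, h2⟩ := hf.sqMulLaplaceDeriv_le_affine (n := n + 1) (by omega) hx
  rcases n with _ | n
  · rw [sqMulLaplaceDeriv_one_affine α β hx] at h2
    have := h1 rfl
    simp at h2 ⊢
    linarith
  · rw [sqMulLaplaceDeriv_add_two_affine n α β hx, mul_zero, pow_succ] at h2
    linarith

/-! ### Smoothness, limit at 0, and part (i) -/

theorem iteratedDerivWithin_Ioi_of_hasDerivAt {D : ℕ → ℝ → ℝ}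
    (hD : ∀ n x, 0 < x → HasDerivAt (D n) (D (n + 1) x) x) (n : ℕ) :
    EqOn (iteratedDerivWithin n (D 0) (Ioi 0)) (D n) (Ioi 0) := by
  induction n with
  | zero => intro x _; simp
  | succ n ih =>
    intro x hx
    rw [iteratedDerivWithin_succ, derivWithin_congr ih (ih hx),
      (hD n x hx).hasDerivWithinAt.derivWithin (uniqueDiffOn_Ioi 0 x hx)]

theorem contDiffOn_Ioi_of_hasDerivAt {D : ℕ → ℝ → ℝ}
    (hD : ∀ n x, 0 < x → HasDerivAt (D n) (D (n + 1) x) x) :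
    ContDiffOn ℝ ∞ (D 0) (Ioi 0) := by
  refine contDiffOn_of_differentiableOn_deriv fun m _ => ?_
  refine DifferentiableOn.congr (f := D m) (fun x hx => ?_)
    (iteratedDerivWithin_Ioi_of_hasDerivAt hD m)
  exact (hD m x hx).differentiableAt.differentiableWithinAt

/-- A non-decreasing differentiable function on `]0,∞[` bounded below has a derivative which is
locally integrable on `[0,∞[`. -/
theorem locallyIntegrableOn_deriv_of_nonneg {g g' : ℝ → ℝ} {c : ℝ}
    (hg : ∀ x, 0 < x → HasDerivAt g (g' x) x) (hg' : ∀ x, 0 < x → 0 ≤ g' x)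
    (hc : Tendsto g (𝓝[>] 0) (𝓝 c)) : LocallyIntegrableOn g' (Ici 0) volume := by
  have hint : ∀ b : ℝ, IntegrableOn g' (Ioc 0 b) := by
    intro b
    -- Giving g its limit c at 0 makes it continuous on the closed interval.
    refine intervalIntegral.integrableOn_deriv_of_nonneg (g := Function.update g 0 c) ?_ ?_
      fun x hx => hg' x hx.1
    · intro x hx
      rcases hx.1.eq_or_lt with rfl | hx0
      · refine ContinuousWithinAt.mono ?_ Icc_subset_Ici_self
        rwa [continuousWithinAt_update_same, Ici_sdiff_left]
      · refine ContinuousAt.continuousWithinAt ?_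
        exact (continuousAt_update_of_ne hx0.ne').2 (hg x hx0).continuousAt
    · intro x hx
      refine (hg x hx.1).congr_of_eventuallyEq ?_
      filter_upwards [eventually_ne_nhds hx.1.ne'] with y hy
      exact Function.update_of_ne hy _ _
  intro x hx
  refine ⟨Icc 0 (x + 1), ?_, (integrableOn_Icc_iff_integrableOn_Ioc ..).2 (hint _)⟩
  rw [mem_nhdsWithin_iff_exists_mem_nhds_inter]
  exact ⟨Iio (x + 1), Iio_mem_nhds (by linarith), fun y hy => ⟨hy.2, le_of_lt hy.1⟩⟩

theorem IsCrF.sq_mul_laplaceTransform_nonneg {f : ℝ → ℝ} (hf : IsCrF f) (x : ℝ) :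
    0 ≤ x ^ 2 * laplaceTransform f x :=
  mul_nonneg (sq_nonneg x) (setIntegral_nonneg measurableSet_Ioi fun t ht =>
    mul_nonneg (Real.exp_pos _).le (hf.1 t (le_of_lt ht)))

theorem IsCrF.exists_tendsto_sq_mul_laplaceTransform {f : ℝ → ℝ} (hf : IsCrF f) :
    ∃ c : ℝ, 0 ≤ c ∧ Tendsto (fun x : ℝ => x ^ 2 * laplaceTransform f x) (𝓝[>] 0) (𝓝 c) := by
  have hD := fun x (hx : 0 < x) => hf.hasDerivAt_sqMulLaplaceDeriv 0 hx
  rw [sqMulLaplaceDeriv_zero] at hD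
  have hmono : MonotoneOn (fun x : ℝ => x ^ 2 * laplaceTransform f x) (Ioi 0) := by
    refine monotoneOn_of_deriv_nonneg (convex_Ioi 0)
      (fun x hx => (hD x hx).continuousAt.continuousWithinAt) ?_ ?_
    · rw [interior_Ioi]
      exact fun x hx => (hD x hx).differentiableAt.differentiableWithinAt
    · rw [interior_Ioi]
      intro x hx
      rw [(hD x hx).deriv]
      simpa using hf.sqMulLaplaceDeriv_succ_nonneg 0 hx
  have h := hmono.tendsto_nhdsGT ⟨0, by
    rintro _ ⟨x, _, rfl⟩
    exact hf.sq_mul_laplaceTransform_nonneg x⟩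
  exact ⟨_, ge_of_tendsto' h hf.sq_mul_laplaceTransform_nonneg, h⟩

theorem IsCrF.isBernsteinFunction {f : ℝ → ℝ} (hf : IsCrF f) :
    IsBernsteinFunction (fun x : ℝ => x ^ 2 * laplaceTransform f x) := by
  have hD := fun x (hx : 0 < x) => hf.hasDerivAt_sqMulLaplaceDeriv 0 hx
  rw [sqMulLaplaceDeriv_zero] at hD
  have hd : EqOn (deriv fun x : ℝ => x ^ 2 * laplaceTransform f x)
    (sqMulLaplaceDeriv f 1) (Ioi 0) := fun x hx => (hD x hx).deriv
  have hD' := fun n x (hx : 0 < x) => hf.hasDerivAt_sqMulLaplaceDeriv (n + 1) hx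
  refine ⟨fun x _ => hf.sq_mul_laplaceTransform_nonneg x,
    fun x hx => (hD x hx).differentiableAt.differentiableWithinAt, ⟨?_, fun n x hx => ?_⟩, ?_⟩
  · exact (contDiffOn_Ioi_of_hasDerivAt (D := fun n => sqMulLaplaceDeriv f (n + 1)) hD').congr hd
  · rw [iteratedDerivWithin_congr hd hx, iteratedDerivWithin_Ioi_of_hasDerivAt
      (D := fun n => sqMulLaplaceDeriv f (n + 1)) hD' n hx]
    exact hf.sqMulLaplaceDeriv_succ_nonneg n hx
  · obtain ⟨c, _, hc⟩ := hf.exists_tendsto_sq_mul_laplaceTransform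
    refine locallyIntegrableOn_deriv_of_nonneg (fun x hx => ?_) (fun x hx => ?_) hc
    · exact (hD x hx).differentiableAt.hasDerivAt
    · rw [hd hx]
      simpa using hf.sqMulLaplaceDeriv_succ_nonneg 0 hx

/-! ### The cone of functions x² g̃(x) -/

theorem IsCrF.add {f g : ℝ → ℝ} (hf : IsCrF f) (hg : IsCrF g) : IsCrF (fun t => f t + g t) :=
  ⟨fun t ht => add_nonneg (hf.1 t ht) (hg.1 t ht), hf.2.1.add hg.2.1, hf.2.2.add hg.2.2⟩

theorem IsCrF.const_mul {f : ℝ → ℝ} (hf : IsCrF f) {c : ℝ} (hc : 0 ≤ c) :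
    IsCrF (fun t => c * f t) :=
  ⟨fun t ht => mul_nonneg hc (hf.1 t ht),
    fun _ hs _ ht hst => mul_le_mul_of_nonneg_left (hf.2.1 hs ht hst) hc, hf.2.2.smul hc⟩

theorem isCrF_id : IsCrF fun t => t :=
  ⟨fun _ ht => ht, monotoneOn_id, concaveOn_id (convex_Ici 0)⟩

theorem isCrF_min {u : ℝ} (hu : 0 ≤ u) : IsCrF fun t => min t u :=
  ⟨fun _ ht => le_min ht hu, fun _ _ _ _ hst => min_le_min_right u hst,
    (concaveOn_id (convex_Ici 0)).inf (concaveOn_const u (convex_Ici 0))⟩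

/-- `f` agrees on `]0,∞[` with `x ^ 2 * laplaceTransform g x` for some CrF `g`. -/
def IsSqMulLaplaceOfCrF (f : ℝ → ℝ) : Prop :=
  ∃ g : ℝ → ℝ, IsCrF g ∧ ∀ x : ℝ, 0 < x → f x = x ^ 2 * laplaceTransform g x

namespace IsSqMulLaplaceOfCrF

theorem add {f₁ f₂ : ℝ → ℝ} (h₁ : IsSqMulLaplaceOfCrF f₁) (h₂ : IsSqMulLaplaceOfCrF f₂) :
    IsSqMulLaplaceOfCrF (fun x => f₁ x + f₂ x) := by
  obtain ⟨g₁, hg₁, e₁⟩ := h₁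
  obtain ⟨g₂, hg₂, e₂⟩ := h₂
  refine ⟨_, hg₁.add hg₂, fun x hx => ?_⟩
  beta_reduce
  rw [e₁ x hx, e₂ x hx, ← mul_add, laplaceTransform, laplaceTransform,
    ← integral_add (hg₁.hasLaplaceTransformAt hx) (hg₂.hasLaplaceTransformAt hx), laplaceTransform]
  simp_rw [mul_add]

theorem const_mul {f : ℝ → ℝ} (h : IsSqMulLaplaceOfCrF f) {c : ℝ} (hc : 0 ≤ c) :
    IsSqMulLaplaceOfCrF (fun x => c * f x) := by
  obtain ⟨g, hg, e⟩ := h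
  refine ⟨_, hg.const_mul hc, fun x hx => ?_⟩
  simp_rw [e x hx, laplaceTransform, mul_left_comm _ c, integral_const_mul]
  ring

theorem const {b : ℝ} (hb : 0 ≤ b) : IsSqMulLaplaceOfCrF fun _ => b := by
  have h : IsSqMulLaplaceOfCrF fun _ => 1 := by
    refine ⟨_, isCrF_id, fun x hx => ?_⟩
    have := integral_exp_neg_mul_pow 1 hx
    simp only [pow_one] at this
    rw [laplaceTransform, this]
    simp [hx.ne']
  simpa using h.const_mul hb

theorem one_sub_exp {u : ℝ} (hu : 0 < u) :
    IsSqMulLaplaceOfCrF fun x => 1 - Real.exp (-(x * u)) := by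
  refine ⟨_, isCrF_min hu.le, fun x hx => ?_⟩
  have hint := (isCrF_min hu.le).hasLaplaceTransformAt hx
  have hd1 : ∀ t : ℝ, HasDerivAt (fun t => Real.exp (-(x * t))) (-x * Real.exp (-(x * t))) t := by
    intro t
    have h1 : HasDerivAt (fun t : ℝ => -(x * t)) (-x) t := by
      simpa using ((hasDerivAt_id' t).const_mul x).fun_neg
    exact h1.exp.congr_deriv (by ring)
  have hlim : Tendsto (fun t : ℝ => Real.exp (-(x * t))) atTop (𝓝 0) :=
    Real.tendsto_exp_neg_atTop_nhds_zero.comp (tendsto_id.const_mul_atTop hx)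
  have h2 : ∫ t in Ioi u, Real.exp (-(x * t)) * min t u = u / x * Real.exp (-(x * u)) := by
    have := integral_Ioi_of_hasDerivAt_of_tendsto' (a := u) (m := 0)
      (f := fun t => -(u / x) * Real.exp (-(x * t)))
      (f' := fun t => u * Real.exp (-(x * t))) (fun t _ => by
        refine ((hd1 t).const_mul (-(u / x))).congr_deriv ?_
        field_simp) ?_ (by simpa using hlim.const_mul (-(u / x)))
    · rw [setIntegral_congr_fun (g := fun t => u * Real.exp (-(x * t))) measurableSet_Ioi
        (fun t (ht : u < t) => by simp only [min_eq_right ht.le, mul_comm]), this]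
      ring
    · refine IntegrableOn.congr_fun (hint.mono_set (Ioi_subset_Ioi hu.le))
        (fun t (ht : u < t) => by simp only [min_eq_right ht.le, mul_comm]) measurableSet_Ioi
  have h1 : ∫ t in Ioc 0 u, Real.exp (-(x * t)) * min t u =
      1 / x ^ 2 - (u / x + 1 / x ^ 2) * Real.exp (-(x * u)) := by
    have := intervalIntegral.integral_eq_sub_of_hasDerivAt (a := 0) (b := u)
      (f := fun t => -(t / x + 1 / x ^ 2) * Real.exp (-(x * t)))
      (f' := fun t => Real.exp (-(x * t)) * t) (fun t _ => by
        refine ((((hasDerivAt_id' t).div_const x).add_const (1 / x ^ 2)).fun_neg.mul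
          (hd1 t)).congr_deriv ?_
        field_simp
        ring) (Continuous.intervalIntegrable (by fun_prop) _ _)
    rw [intervalIntegral.integral_of_le hu.le] at this
    rw [setIntegral_congr_fun (g := fun t => Real.exp (-(x * t)) * t) measurableSet_Ioc
      (fun t (ht : t ∈ Ioc 0 u) => by simp only [min_eq_left ht.2]), this]
    simp
    ring
  rw [laplaceTransform, ← Ioc_union_Ioi_eq_Ioi hu.le,
    setIntegral_union (Ioc_disjoint_Ioi le_rfl) measurableSet_Ioi
      (hint.mono_set Ioc_subset_Ioi_self) (hint.mono_set (Ioi_subset_Ioi hu.le)), h1, h2]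
  field_simp
  ring

theorem congr {f₁ f₂ : ℝ → ℝ} (h₁ : IsSqMulLaplaceOfCrF f₁) (h : ∀ x, 0 < x → f₂ x = f₁ x) :
    IsSqMulLaplaceOfCrF f₂ := by
  obtain ⟨g, hg, e⟩ := h₁
  exact ⟨g, hg, fun x hx => (h x hx).trans (e x hx)⟩

theorem sum {ι : Type*} (s : Finset ι) {f : ι → ℝ → ℝ} (h : ∀ i ∈ s, IsSqMulLaplaceOfCrF (f i)) :
    IsSqMulLaplaceOfCrF fun x => ∑ i ∈ s, f i x := by
  classical
  induction s using Finset.induction_on with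
  | empty => simpa using const le_rfl
  | insert i s hi ih =>
    simp only [Finset.sum_insert hi]
    exact (h i (Finset.mem_insert_self i s)).add
      (ih fun j hj => h j (Finset.mem_insert_of_mem hj))

end IsSqMulLaplaceOfCrF

/-! ### Closure of the cone under pointwise limits -/

/-- The Laplace transform controls the pointwise values of a CrF. -/
theorem IsCrF.le_exp_mul {g : ℝ → ℝ} (hg : IsCrF g) {x t : ℝ} (hx : 0 < x) (ht : 0 ≤ t) :
    g t ≤ Real.exp (x * t) * (x * laplaceTransform g x) := by
  have hint := hg.hasLaplaceTransformAt hx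
  have hexp : IntegrableOn (fun s : ℝ => Real.exp (-(x * s))) (Ioi 0) := by
    simpa using integrableOn_exp_neg_mul_pow 0 hx
  have hexp' := hexp.mono_set (Ioi_subset_Ioi ht)
  have h1 : ∫ s in Ioi t, Real.exp (-(x * s)) * g t ≤ laplaceTransform g x :=
    calc ∫ s in Ioi t, Real.exp (-(x * s)) * g t
        ≤ ∫ s in Ioi t, Real.exp (-(x * s)) * g s :=
          setIntegral_mono_on (hexp'.mul_const _) (hint.mono_set (Ioi_subset_Ioi ht))
            measurableSet_Ioi fun s (hs : t < s) => mul_le_mul_of_nonneg_left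
              (hg.2.1 ht (ht.trans hs.le) hs.le) (Real.exp_pos _).le
      _ ≤ laplaceTransform g x := by
          refine setIntegral_mono_set hint ?_ (Ioi_subset_Ioi ht).eventuallyLE
          filter_upwards [self_mem_ae_restrict measurableSet_Ioi] with s hs
          exact mul_nonneg (Real.exp_pos _).le (hg.1 s (le_of_lt hs))
  have h2 : ∫ s in Ioi t, Real.exp (-(x * s)) = Real.exp (-(x * t)) / x := by
    have := integral_exp_mul_Ioi (a := -x) (by linarith) t
    simpa [neg_mul, neg_div_neg_eq] using this
  rw [integral_mul_const, h2] at h1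
  have e : g t = Real.exp (x * t) * (x * (Real.exp (-(x * t)) / x * g t)) := by
    rw [Real.exp_neg]
    field_simp
  rw [e]
  gcongr

/-- Helly's selection principle for CrFs. -/
theorem exists_subseq_tendsto_isCrF {g : ℕ → ℝ → ℝ} (hg : ∀ n, IsCrF (g n)) {B : ℝ → ℝ}
    (hB : ∀ n t, 0 ≤ t → g n t ≤ B t) :
    ∃ φ : ℕ → ℕ, StrictMono φ ∧ ∃ h : ℝ → ℝ, IsCrF h ∧
      ∀ t, 0 < t → Tendsto (fun k => g (φ k) t) atTop (𝓝 (h t)) := by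
  -- A countable product of intervals is sequentially compact; the absolute value keeps every index
  -- in [0,∞[.
  have hK : IsCompact (univ.pi fun q : ℚ => Icc 0 (B |(q : ℝ)|)) :=
    isCompact_univ_pi fun _ => isCompact_Icc
  obtain ⟨a, -, φ, hφ, ha⟩ := hK.tendsto_subseq (x := fun n (q : ℚ) => g n |(q : ℝ)|)
    fun n q _ => ⟨(hg n).1 _ (abs_nonneg _), hB n _ (abs_nonneg _)⟩
  rw [tendsto_pi_nhds] at ha
  -- An ultrafilter limit exists at every t ≥ 0 and is again a CrF. At positive rationals it is the
  -- limit of the subsequence; monotonicity and continuity of the concave limit extend this to all t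
  -- > 0.
  let U : Ultrafilter ℕ := Ultrafilter.of atTop
  have hU : (U : Filter ℕ) ≤ atTop := Ultrafilter.of_le atTop
  have hlim : ∀ t : ℝ, ∃ l : ℝ, 0 ≤ t → Tendsto (fun k => g (φ k) t) U (𝓝 l) := by
    intro t
    by_cases ht : 0 ≤ t
    · obtain ⟨l, -, hl⟩ := (isCompact_Icc (a := 0) (b := B t)).ultrafilter_le_nhds
        (U.map fun k => g (φ k) t) (by
          rw [le_principal_iff]
          exact mem_map.2 (univ_mem' fun k => ⟨(hg _).1 t ht, hB _ t ht⟩))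
      exact ⟨l, fun _ => hl⟩
    · exact ⟨0, fun h => absurd h ht⟩
  choose h hh using hlim
  have hcrf : IsCrF h := by
    refine ⟨fun t ht => ge_of_tendsto' (hh t ht) fun k => (hg _).1 t ht, fun s hs t ht hst =>
      le_of_tendsto_of_tendsto' (hh s hs) (hh t ht) fun k => (hg _).2.1 hs ht hst,
      convex_Ici 0, fun s hs t ht α β hα hβ hαβ => ?_⟩
    exact le_of_tendsto_of_tendsto' (((hh s hs).const_smul α).add ((hh t ht).const_smul β))
      (hh _ ((convex_Ici 0) hs ht hα hβ hαβ)) fun k => (hg _).2.2.2 hs ht hα hβ hαβ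
  have hrat : ∀ q : ℚ, 0 < (q : ℝ) → Tendsto (fun k => g (φ k) q) atTop (𝓝 (h q)) := by
    intro q hq
    have h1 := ha q
    simp only [Function.comp_def, abs_of_pos hq] at h1
    rwa [tendsto_nhds_unique (hh q hq.le) (h1.mono_left hU)]
  refine ⟨φ, hφ, h, hcrf, fun t ht => ?_⟩
  have hcont : ContinuousAt h t := by
    have := hcrf.2.2.continuousOn_interior
    rw [interior_Ici] at this
    exact this.continuousAt (Ioi_mem_nhds ht)
  refine tendsto_order.2 ⟨fun c hc => ?_, fun c hc => ?_⟩
  · obtain ⟨l, hl, hl'⟩ := exists_Ioc_subset_of_mem_nhds (hcont.eventually_const_lt hc) ⟨0, ht⟩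
    obtain ⟨q, hq1, hq2⟩ := exists_rat_btwn (max_lt hl ht)
    have hq0 : 0 < (q : ℝ) := (le_max_right _ _).trans_lt hq1
    filter_upwards [(hrat q hq0).eventually_const_lt
      (hl' ⟨(le_max_left _ _).trans_lt hq1, hq2.le⟩)] with k hk
    exact hk.trans_le ((hg _).2.1 hq0.le ht.le hq2.le)
  · obtain ⟨r, hr, hr'⟩ := exists_Ico_subset_of_mem_nhds (hcont.eventually_lt_const hc)
      ⟨t + 1, by linarith⟩
    obtain ⟨q, hq1, hq2⟩ := exists_rat_btwn hr
    have hq0 : 0 < (q : ℝ) := ht.trans hq1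
    filter_upwards [(hrat q hq0).eventually_lt_const (hr' ⟨hq1.le, hq2⟩)] with k hk
    exact ((hg _).2.1 ht.le hq0.le hq1.le).trans_lt hk

/-- Boundedness of F n x in n bounds the CrFs pointwise, so Helly applies. The same bound at x/2
dominates the integrands at x by a multiple of e^{-xt/2}. -/
theorem IsSqMulLaplaceOfCrF.of_tendsto {F : ℕ → ℝ → ℝ} {f : ℝ → ℝ}
    (hF : ∀ n, IsSqMulLaplaceOfCrF (F n))
    (hlim : ∀ x, 0 < x → Tendsto (fun n => F n x) atTop (𝓝 (f x))) :
    IsSqMulLaplaceOfCrF f := by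
  choose g hg e using hF
  have hbdd : ∀ x : ℝ, ∃ C : ℝ, 0 < x → ∀ n, F n x ≤ C := by
    intro x
    by_cases hx : 0 < x
    · obtain ⟨C, hC⟩ := (hlim x hx).bddAbove_range
      exact ⟨C, fun _ n => hC ⟨n, rfl⟩⟩
    · exact ⟨0, fun h => absurd h hx⟩
  choose C hC using hbdd
  have hle : ∀ n x t, 0 < x → 0 ≤ t → g n t ≤ Real.exp (x * t) * (C x / x) := by
    intro n x t hx ht
    refine ((hg n).le_exp_mul hx ht).trans ?_
    gcongr
    rw [le_div_iff₀ hx]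
    refine le_of_eq_of_le ?_ (hC x hx n)
    rw [e n x hx]
    ring
  obtain ⟨φ, hφ, h, hh, hφh⟩ := exists_subseq_tendsto_isCrF hg
    (B := fun t => Real.exp (1 * t) * (C 1 / 1)) fun n t ht => hle n 1 t one_pos ht
  refine ⟨h, hh, fun x hx => ?_⟩
  have hdct : Tendsto (fun k => laplaceTransform (g (φ k)) x) atTop
      (𝓝 (laplaceTransform h x)) := by
    refine tendsto_integral_of_dominated_convergence
      (fun t => Real.exp (-(x / 2 * t)) * (C (x / 2) / (x / 2)))
      (fun k => ((hg _).hasLaplaceTransformAt hx).aestronglyMeasurable) ?_ (fun k => ?_) ?_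
    · have : IntegrableOn (fun t : ℝ => Real.exp (-(x / 2 * t))) (Ioi 0) := by
        simpa using integrableOn_exp_neg_mul_pow 0 (half_pos hx)
      exact this.mul_const _
    · filter_upwards [self_mem_ae_restrict measurableSet_Ioi] with t ht
      have ht : 0 < t := ht
      rw [Real.norm_of_nonneg (mul_nonneg (Real.exp_pos _).le ((hg _).1 t ht.le))]
      refine (mul_le_mul_of_nonneg_left (hle _ _ t (half_pos hx) ht.le)
        (Real.exp_pos _).le).trans_eq ?_
      rw [← mul_assoc, ← Real.exp_add]
      congr 2
      ring
    · filter_upwards [self_mem_ae_restrict measurableSet_Ioi] with t ht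
      exact (hφh t ht).const_mul _
  refine tendsto_nhds_unique ((hlim x hx).comp hφ.tendsto_atTop) ?_
  refine (hdct.const_mul (x ^ 2)).congr fun k => ?_
  exact (e _ x hx).symm

/-! ### Taylor expansion of Bernstein functions, and part (ii) -/

/-- The Taylor polynomial of order `n` at `y`, evaluated at `x`, built from a sequence `D` of
successive derivatives. -/
noncomputable def taylorSum (D : ℕ → ℝ → ℝ) (n : ℕ) (x y : ℝ) : ℝ :=
  ∑ k ∈ Finset.range (n + 1), D k y * (x - y) ^ k / k.factorial

theorem taylorSum_self (D : ℕ → ℝ → ℝ) (n : ℕ) (x : ℝ) : taylorSum D n x x = D 0 x := by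
  simp [taylorSum, Finset.sum_range_succ']

theorem continuous_taylorSum_left (D : ℕ → ℝ → ℝ) (n : ℕ) (y : ℝ) :
    Continuous fun x => taylorSum D n x y := by
  unfold taylorSum
  fun_prop

theorem hasDerivAt_taylorSum {D : ℕ → ℝ → ℝ} {y : ℝ} (hD : ∀ n, HasDerivAt (D n) (D (n + 1) y) y)
    (n : ℕ) (x : ℝ) :
    HasDerivAt (taylorSum D n x) (D (n + 1) y * (x - y) ^ n / n.factorial) y := by
  have hxy : HasDerivAt (fun y => x - y) (-1) y := by
    simpa using (hasDerivAt_id' y).const_sub x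
  induction n with
  | zero =>
    have : taylorSum D 0 x = D 0 := by
      ext
      simp [taylorSum]
    simpa [this] using hD 0
  | succ n ih =>
    have : taylorSum D (n + 1) x = fun y => taylorSum D n x y +
        D (n + 1) y * (x - y) ^ (n + 1) / (n + 1).factorial := by
      ext y
      rw [taylorSum, Finset.sum_range_succ]
      rfl
    rw [this]
    refine (ih.add (((hD (n + 1)).mul (hxy.pow (n + 1))).div_const _)).congr_deriv ?_
    have h1 : (n.factorial : ℝ) ≠ 0 := by positivity
    simp only [Nat.factorial_succ, Nat.add_sub_cancel]
    push_cast
    field_simp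
    simp only [Pi.pow_apply]
    ring

/-- Sign conditions satisfied by the derivatives of a Bernstein function. -/
structure IsBernsteinSequence (D : ℕ → ℝ → ℝ) : Prop where
  hasDerivAt : ∀ n x, 0 < x → HasDerivAt (D n) (D (n + 1) x) x
  nonneg : ∀ x, 0 < x → 0 ≤ D 0 x
  succ_nonneg : ∀ n x, 0 < x → 0 ≤ (-1) ^ n * D (n + 1) x

namespace IsBernsteinSequence

variable {D : ℕ → ℝ → ℝ}

/-- The derivative in the base point y is (-1)^n D (n+1) y (c(y-z)^n - (y-x)^n)/n!. This compares
Taylor remainders at z and x without an integral formula. -/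
theorem mul_taylorSum_sub_monotoneOn (hD : IsBernsteinSequence D) (n : ℕ)
    {z x T c : ℝ} (hx : 0 < x)
    (hc : ∀ y ∈ Icc x T, (y - x) ^ n ≤ c * (y - z) ^ n) :
    MonotoneOn (fun y => c * taylorSum D n z y - taylorSum D n x y) (Icc x T) := by
  have hd : ∀ y ∈ Icc x T, HasDerivAt (fun y => c * taylorSum D n z y - taylorSum D n x y)
      (c * (D (n + 1) y * (z - y) ^ n / n.factorial) -
        D (n + 1) y * (x - y) ^ n / n.factorial) y := fun y hy =>
    ((hasDerivAt_taylorSum (fun k => hD.hasDerivAt k y (hx.trans_le hy.1)) n z).const_mul c).sub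
      (hasDerivAt_taylorSum (fun k => hD.hasDerivAt k y (hx.trans_le hy.1)) n x)
  refine monotoneOn_of_deriv_nonneg (convex_Icc x T)
    (fun y hy => (hd y hy).continuousAt.continuousWithinAt)
    (fun y hy => (hd y (interior_subset hy)).differentiableAt.differentiableWithinAt)
    fun y hy => ?_
  replace hy := interior_subset hy
  rw [(hd y hy).deriv]
  have e : c * (D (n + 1) y * (z - y) ^ n / n.factorial) -
      D (n + 1) y * (x - y) ^ n / n.factorial =
      ((-1) ^ n * D (n + 1) y) * (c * (y - z) ^ n - (y - x) ^ n) / n.factorial := by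
    rw [← neg_sub y z, ← neg_sub y x, neg_pow (y - z), neg_pow (y - x)]
    ring
  rw [e]
  exact div_nonneg (mul_nonneg (hD.succ_nonneg n y (hx.trans_le hy.1)) (sub_nonneg.2 (hc y hy)))
    (by positivity)

theorem le_taylorSum (hD : IsBernsteinSequence D) (n : ℕ) {x T : ℝ} (hx : 0 < x) (hT : x ≤ T) :
    D 0 x ≤ taylorSum D n x T := by
  -- With z = x and c = 2 the difference is the Taylor sum itself.
  have h := hD.mul_taylorSum_sub_monotoneOn n (z := x) (x := x) (T := T) (c := 2) hx fun y hy => by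
    have := pow_nonneg (sub_nonneg.2 hy.1) n
    linarith
  have := h ⟨le_rfl, hT⟩ ⟨hT, le_rfl⟩ hT
  simp only [taylorSum_self] at this
  linarith

theorem taylorSum_le (hD : IsBernsteinSequence D) (n : ℕ) {z T : ℝ} (hT : 0 < T) (hz : z ≤ T) :
    taylorSum D n z T ≤ D 0 T := by
  rw [taylorSum, Finset.sum_range_succ']
  simp only [pow_zero, Nat.factorial_zero, Nat.cast_one, mul_one, div_one]
  refine add_le_of_nonpos_left (Finset.sum_nonpos fun k _ => ?_)
  refine div_nonpos_of_nonpos_of_nonneg ?_ (by positivity)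
  have := mul_nonneg (hD.succ_nonneg k T hT) (pow_nonneg (sub_nonneg.2 hz) (k + 1))
  rw [← neg_sub T z, neg_pow, pow_succ (-1 : ℝ)]
  linarith

/-- (y-x)/(y-z) increases in y, so its value at T gives the constant c. The Taylor sums at z lie
between 0 and D 0 T, and the ratio is < 1, which forces geometric convergence. -/
theorem taylorSum_sub_le (hD : IsBernsteinSequence D) (n : ℕ) {z x T : ℝ} (hz : 0 < z)
    (hzx : z < x) (hT : x ≤ T) : taylorSum D n x T - D 0 x ≤ ((T - x) / (T - z)) ^ n * D 0 T := by
  set c := ((T - x) / (T - z)) ^ n with hc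
  have hx := hz.trans hzx
  have hc0 : 0 ≤ c := pow_nonneg (div_nonneg (by linarith) (by linarith)) n
  have h := hD.mul_taylorSum_sub_monotoneOn n (z := z) (x := x) (T := T) (c := c) hx fun y hy => by
    rw [hc, ← mul_pow]
    refine pow_le_pow_left₀ (sub_nonneg.2 hy.1) ?_ n
    rw [div_mul_eq_mul_div, le_div_iff₀ (by linarith)]
    nlinarith [hy.2]
  have h1 := h ⟨le_rfl, hT⟩ ⟨hT, le_rfl⟩ hT
  simp only [taylorSum_self] at h1
  have h2 := (hD.nonneg z hz).trans (hD.le_taylorSum n hz le_rfl)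
  have h3 : 0 ≤ taylorSum D n z x := (hD.nonneg z hz).trans (hD.le_taylorSum n hz hzx.le)
  have h4 := mul_nonneg hc0 h3
  have h5 := mul_le_mul_of_nonneg_left (hD.taylorSum_le n (hx.trans_le hT) (hzx.le.trans hT)) hc0
  linarith

theorem tendsto_taylorSum (hD : IsBernsteinSequence D) {x T : ℝ} (hx : 0 < x) (hT : x ≤ T) :
    Tendsto (fun n => taylorSum D n x T) atTop (𝓝 (D 0 x)) := by
  have h1 : Tendsto (fun n : ℕ => D 0 x + ((T - x) / (T - x / 2)) ^ n * D 0 T) atTop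
      (𝓝 (D 0 x)) := by
    have hp : 0 < T - x / 2 := by linarith
    have := tendsto_pow_atTop_nhds_zero_of_lt_one (r := (T - x) / (T - x / 2))
      (div_nonneg (by linarith) hp.le) (by rw [div_lt_one hp]; linarith)
    simpa using (this.mul_const (D 0 T)).const_add (D 0 x)
  refine tendsto_of_tendsto_of_tendsto_of_le_of_le tendsto_const_nhds h1
    (fun n => hD.le_taylorSum n hx hT) fun n => ?_
  have := hD.taylorSum_sub_le n (half_pos hx) (half_lt_self hx) hT
  simp only
  linarith

theorem taylorSum_zero_nonneg (hD : IsBernsteinSequence D) (n : ℕ) {T : ℝ} (hT : 0 < T) :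
    0 ≤ taylorSum D n 0 T := by
  refine ge_of_tendsto (((continuous_taylorSum_left D n T).tendsto 0).mono_left
    (nhdsWithin_le_nhds (s := Ioi 0))) ?_
  filter_upwards [Ioc_mem_nhdsGT hT] with x hx
  exact (hD.nonneg x hx.1).trans (hD.le_taylorSum n hx.1 hx.2)

/-- The increment from T is -T e^{-x/T}, so the k-th term is a non-positive multiple of e^{-kx/T}
for k ≥ 1. Writing e^{-kx/T} = 1 - (1 - e^{-kx/T}) leaves the Taylor sum at 0 as constant term. -/
theorem isSqMulLaplaceOfCrF_taylorSum (hD : IsBernsteinSequence D) (n : ℕ) {T : ℝ}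
    (hT : 0 < T) :
    IsSqMulLaplaceOfCrF fun x => taylorSum D n (T * (1 - Real.exp (-(x / T)))) T := by
  have h := (IsSqMulLaplaceOfCrF.const (hD.taylorSum_zero_nonneg n hT)).add
    (IsSqMulLaplaceOfCrF.sum (Finset.range n)
      (f := fun k x => ((-1) ^ k * D (k + 1) T * T ^ (k + 1) / (k + 1).factorial) *
        (1 - Real.exp (-(x * ((k + 1) / T))))) fun k _ =>
        (IsSqMulLaplaceOfCrF.one_sub_exp (by positivity)).const_mul
          (div_nonneg (mul_nonneg (hD.succ_nonneg k T hT) (by positivity)) (by positivity)))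
  refine h.congr fun x _ => ?_
  simp only [taylorSum, Finset.sum_range_succ' _ n]
  rw [add_right_comm, ← Finset.sum_add_distrib]
  congr 1
  refine Finset.sum_congr rfl fun k _ => ?_
  have e1 : T * (1 - Real.exp (-(x / T))) - T = -1 * (T * Real.exp (-(x / T))) := by ring
  have e2 : Real.exp (-(x * ((k + 1) / T))) = Real.exp (-(x / T)) ^ (k + 1) := by
    rw [← Real.exp_nat_mul]
    congr 1
    push_cast
    ring
  rw [e1, e2, zero_sub, neg_pow T, mul_pow, mul_pow, pow_succ (-1 : ℝ)]
  ring

theorem isSqMulLaplaceOfCrF (hD : IsBernsteinSequence D) : IsSqMulLaplaceOfCrF (D 0) := by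
  have hpos : ∀ n : ℕ, (0 : ℝ) < n + 1 := fun n => by positivity
  refine IsSqMulLaplaceOfCrF.of_tendsto
    (F := fun n x => D 0 ((n + 1) * (1 - Real.exp (-(x / (n + 1)))))) (fun n => ?_) fun x hx => ?_
  · refine IsSqMulLaplaceOfCrF.of_tendsto
      (fun m => hD.isSqMulLaplaceOfCrF_taylorSum m (hpos n)) fun x hx => ?_
    have h1 : Real.exp (-(x / (n + 1))) < 1 := by
      rw [Real.exp_lt_one_iff, neg_lt_zero]
      exact div_pos hx (hpos n)
    refine hD.tendsto_taylorSum (mul_pos (hpos n) (by linarith)) ?_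
    exact mul_le_of_le_one_right (hpos n).le (by linarith [Real.exp_pos (-(x / (n + 1)))])
  · refine (hD.hasDerivAt 0 x hx).continuousAt.tendsto.comp ?_
    -- With s = 1/(n+1), the evaluation point is the difference quotient at 0 of this function,
    -- hence tends to x.
    have hd : HasDerivAt (fun s : ℝ => 1 - Real.exp (-(x * s))) x 0 := by
      have h1 : HasDerivAt (fun s : ℝ => -(x * s)) (-x) 0 := by
        simpa using ((hasDerivAt_id' (0 : ℝ)).const_mul x).fun_neg
      simpa using h1.exp.const_sub 1
    have hs := hd.tendsto_slope_zero_right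
    have hn : Tendsto (fun n : ℕ => 1 / ((n : ℝ) + 1)) atTop (𝓝[>] 0) :=
      tendsto_nhdsWithin_iff.2 ⟨tendsto_one_div_add_atTop_nhds_zero_nat,
        Eventually.of_forall fun n => one_div_pos.2 (hpos n)⟩
    refine (hs.comp hn).congr fun n => ?_
    simp [div_eq_mul_inv]

end IsBernsteinSequence

theorem IsBernsteinFunction.isBernsteinSequence {f : ℝ → ℝ} (hf : IsBernsteinFunction f) :
    IsBernsteinSequence fun n => match n with
      | 0 => f
      | n + 1 => iteratedDerivWithin n (deriv f) (Ioi 0) := by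
  obtain ⟨h0, hd, ⟨hs, hp⟩, -⟩ := hf
  refine ⟨fun n x hx => ?_, h0, fun n x hx => hp n x hx⟩
  have hx' : Ioi 0 ∈ 𝓝 x := Ioi_mem_nhds hx
  rcases n with _ | n
  · simpa using (hd.differentiableAt hx').hasDerivAt
  · have h1 := hs.differentiableOn_iteratedDerivWithin (m := n)
      (by exact_mod_cast ENat.natCast_lt_top n) (uniqueDiffOn_Ioi 0)
    have h2 := (h1.differentiableAt hx').hasDerivAt
    simp only [iteratedDerivWithin_succ]
    rwa [derivWithin_of_mem_nhds hx']

theorem mainTheorem2 :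
    (∀ f : ℝ → ℝ, IsCrF f →
      (∀ x : ℝ, 0 < x → HasLaplaceTransformAt f x) ∧
      IsBernsteinFunction (fun x : ℝ => x ^ 2 * laplaceTransform f x) ∧
      ∃ c : ℝ, 0 ≤ c ∧
        Tendsto (fun x : ℝ => x ^ 2 * laplaceTransform f x) (𝓝[>] 0) (𝓝 c)) ∧
    (∀ f : ℝ → ℝ, IsBernsteinFunction f →
      ∃ g : ℝ → ℝ, IsCrF g ∧
        ∀ x : ℝ, 0 < x →
          HasLaplaceTransformAt g x ∧ f x = x ^ 2 * laplaceTransform g x) := by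
  refine ⟨fun f hf => ⟨fun x hx => hf.hasLaplaceTransformAt hx, hf.isBernsteinFunction,
    hf.exists_tendsto_sq_mul_laplaceTransform⟩, fun f hf => ?_⟩
  obtain ⟨g, hg, h⟩ := hf.isBernsteinSequence.isSqMulLaplaceOfCrF
  exact ⟨g, hg, fun x hx => ⟨hg.hasLaplaceTransformAt hx, h x hx⟩⟩
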